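/- **Setting.** Let $\mathcal B$ be a real Banach space with dual $\mathcal B^\star$. Let $\mathbf W\subset\mathcal B$ be closed, convex, centrally symmetric ($\mathbf W=-\mathbf W$) and absorbing, and let $\mathcal X\subset\mathcal B^\star$ be convex, centrally symmetric and absorbing. (Thus the Minkowski functionals $\|\cdot\|_{\mathbf W}$ on $\mathcal B$ and $\|\cdot\|_{\mathcal X}$ on $\mathcal B^\star$ are finite seminorms.) Write $\|w\|_{\mathcal X^\star}=\sup\{\langle x,w\rangle:\|x\|_{\mathcal X}\le 1\}$. An online algorithm $\mathcal A$ assigns to each finite sequence $f_1,\dots,f_{t-1}$ of cost functions a decision $w_t=\mathcal A(f_{1:t-1})\in\mathbf W$. Its regret is $$\mathbf R_n(\mathcal A,f_{1:n})=\frac1n\sum_{t=1}^n f_t(w_t)-\inf_{w\in\mathbf W}\frac1n\sum_{t=1}^n f_t(w)\in(-\infty,+\infty].$$ The value of the linear game is $\mathcal V_n(\mathbf W,\mathcal X)=\inf_{\mathcal A}\sup_{f_{1:n}}\mathbf R_n(\mathcal A,f_{1:n})$, the supremum being over cost functions of the form $w\mapsto\langle x,w\rangle$ with $x\in\mathcal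 X$. Let $\mathcal F_{\rm Lip}(\mathcal X)$ be the class of all convex $f$ on $\mathbf W$ that have at every $w\in\mathbf W$ a subgradient in $\mathcal X$; it contains these linear functions. A *regularizer* is a convex function $\Psi:\mathcal B\to[0,\infty)$ with $\Psi(0)=0$ for which there is $s\in[2,\infty)$ such that, for all $w,w'\in\mathbf W$ and $\alpha\in[0,1]$, $$\Psi(\alpha w+(1-\alpha)w')\le\alpha\Psi(w)+(1-\alpha)\Psi(w')-\frac{\alpha(1-\alpha)}{s}\|w-w'\|_{\mathcal X^\star}^s .$$ *Mirror Descent* with regularizer $\Psi$ and step size $\eta>0$ plays $w_1\in\arg\min_{w\in\mathbf W}\Psi(w)$ and $$w_{t+1}\in\arg\min_{w\in\mathbf W}\Big(\Psi(w)-\Psi(w_t)-\langle\nabla\Psi(w_t),w-w_t\rangle+\eta\,\langle\nabla f_t(w_t),w-w_t\rangle\Big),$$ where $\nabla f_t(w_t)\in\mathcal X$ is a subgradient of $f_t:\mathbf W\to\mathbb R$ at $w_t$, supplied by an oracle, and $\nabla\Psi(w_t)\in\mathcal B^\star$ is a subgradient of $\Psi:\mathcal B\to\mathbb R$ at $w_t$,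 chosen by the algorithm (possibly depending on the history). **Theorem.** Suppose that for some $V>0$ and some $q\in[2,\infty)$ we have $\mathcal V_m(\mathbf W,\mathcal X)\le V\,m^{-1/q}$ for all integers $m\ge1$. Then for every integer $n>e^{q-1}$ there exist a regularizer $\Psi$ and a step size $\eta>0$ such that, for every oracle selecting subgradients in $\mathcal X$ of the functions in $\mathcal F_{\rm Lip}(\mathcal X)$, there is a Mirror Descent algorithm $\mathcal A_{\rm MD}$ with this $\Psi$, $\eta$ and oracle (in particular, all the minimizers and all the subgradients of $\Psi$ that it uses exist) satisfying $$\mathbf R_n(\mathcal A_{\rm MD},f_{1:n})\le 6002\,V\,\log^2(n)\,n^{-1/q}\qquad\text{for all } f_1,\dots,f_n\in\mathcal F_{\rm Lip}(\mathcal X).$$ -/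

import Mathlib

section OnlineGame

variable {B : Type*} [NormedAddCommGroup B] [NormedSpace ℝ B]

/-- An online learning algorithm with decisions in `W`: it maps the list `[f₁, …, f_{t-1}]` of the
cost functions revealed so far to the next decision `w_t ∈ W`. -/
abbrev OnlineAlgorithm (W : Set B) : Type _ := List (B → ℝ) → W

/-- The (average) regret of the algorithm `A` on the cost functions `f₁, …, f_n`:
`(1/n) ∑ f_t(w_t) - inf_{w ∈ W} (1/n) ∑ f_t(w)`, where `w_t = A(f₁, …, f_{t-1})`.
It lives in `EReal`, so that an infimum equal to `-∞` gives the regret `+∞`. -/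
noncomputable def regret {W : Set B} (A : OnlineAlgorithm W) {n : ℕ} (f : Fin n → B → ℝ) : EReal :=
  (((1 / (n : ℝ)) * ∑ t : Fin n, f t (A ((List.ofFn f).take (t : ℕ)) : B) : ℝ) : EReal) -
    ⨅ w : W, (((1 / (n : ℝ)) * ∑ t : Fin n, f t (w : B) : ℝ) : EReal)

/-- The value of the `n`-round game: the infimum over the algorithms of the worst-case regret. -/
noncomputable def gameValue (W : Set B) (F : Set (B → ℝ)) (n : ℕ) : EReal :=
  ⨅ A : OnlineAlgorithm W, ⨆ f : Fin n → F, regret A (fun t => (f t : B → ℝ))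

/-- The linear cost functions `w ↦ ⟨x, w⟩` with `x ∈ X`. -/
def linearCosts (X : Set (StrongDual ℝ B)) : Set (B → ℝ) :=
  {f | ∃ x ∈ X, f = fun w => x w}

/-- `θ` is a subgradient at `w` of `f`, regarded as a function on the set `S`. -/
def IsSubgradientOn (S : Set B) (f : B → ℝ) (w : B) (θ : StrongDual ℝ B) : Prop :=
  ∀ u ∈ S, f w + θ (u - w) ≤ f u

/-- The convex cost functions on `W` that have, at every point of `W`, a subgradient in `X`.
Only the values of the functions on `W` matter. -/
def convexCosts (W : Set B) (X : Set (StrongDual ℝ B)) : Set (B → ℝ) :=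
  {f | ConvexOn ℝ W f ∧ ∀ w ∈ W, ∃ x ∈ X, IsSubgradientOn W f w x}

/-- The norm on `B` dual to the Minkowski functional of `X`:
`‖w‖ = sup {⟨x, w⟩ : ‖x‖_X ≤ 1}`. -/
noncomputable def dualGauge (X : Set (StrongDual ℝ B)) (w : B) : ℝ :=
  ⨆ x : {x : StrongDual ℝ B // gauge X x ≤ 1}, (x : StrongDual ℝ B) w

/-- `Ψ` is `s`-uniformly convex on `W` with respect to the norm `N`. -/
def IsUniformlyConvexOn (W : Set B) (N : B → ℝ) (s : ℝ) (Ψ : B → ℝ) : Prop :=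
  ∀ w ∈ W, ∀ w' ∈ W, ∀ α ∈ Set.Icc (0 : ℝ) 1,
    Ψ (α • w + (1 - α) • w') ≤
      α * Ψ w + (1 - α) * Ψ w' - α * (1 - α) / s * N (w - w') ^ s

/-- Regularizers (distance generating functions): non-negative convex functions on `B` that vanish
at the origin and are `s`-uniformly convex on `W` with respect to the norm dual to `‖·‖_X`, for
some `s ∈ [2, ∞)`. -/
structure IsRegularizer (W : Set B) (X : Set (StrongDual ℝ B)) (Ψ : B → ℝ) : Prop where
  convex : ConvexOn ℝ Set.univ Ψ
  nonneg : ∀ w, 0 ≤ Ψ w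
  map_zero : Ψ 0 = 0
  uniformlyConvex : ∃ s : ℝ, 2 ≤ s ∧ IsUniformlyConvexOn W (dualGauge X) s Ψ

/-- The Bregman divergence `Ψ(w) - Ψ(w') - ⟨θ, w - w'⟩`, where `θ` is the (sub)gradient of `Ψ` at
`w'` that is used. -/
def bregman (Ψ : B → ℝ) (θ : StrongDual ℝ B) (w w' : B) : ℝ :=
  Ψ w - Ψ w' - θ (w - w')

/-- `grad` is a subgradient oracle: `grad f w` is a subgradient in `X` of the cost function `f`
at the point `w ∈ W`. -/
def IsSubgradientOracle (W : Set B) (X : Set (StrongDual ℝ B))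
    (grad : (B → ℝ) → B → StrongDual ℝ B) : Prop :=
  ∀ f ∈ convexCosts W X, ∀ w ∈ W, grad f w ∈ X ∧ IsSubgradientOn W f w (grad f w)

/-- `A` is Mirror Descent on `W` with regularizer `Ψ`, step size `η` and subgradient oracle `grad`,
played against cost functions from `convexCosts W X`:
`w₁` minimizes `Ψ` over `W`, and `w_{t+1}` minimizes
`D_Ψ(w | w_t) + η ⟨∇f_t(w_t), w - w_t⟩` over `w ∈ W`.
`gradΨ h` is the subgradient of `Ψ` (as a function on all of `B`) at the decision `A h` made after
the history `h` that serves as `∇Ψ(w_t)` in the Bregman divergence. -/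
structure IsMirrorDescent {W : Set B} (X : Set (StrongDual ℝ B)) (Ψ : B → ℝ) (η : ℝ)
    (grad : (B → ℝ) → B → StrongDual ℝ B) (gradΨ : List (B → ℝ) → StrongDual ℝ B)
    (A : OnlineAlgorithm W) : Prop where
  subgradient : ∀ h : List (B → ℝ), (∀ f ∈ h, f ∈ convexCosts W X) →
    IsSubgradientOn Set.univ Ψ (A h) (gradΨ h)
  init : IsMinOn Ψ W (A [])
  step : ∀ h : List (B → ℝ), (∀ f ∈ h, f ∈ convexCosts W X) → ∀ f ∈ convexCosts W X,
    IsMinOn (fun w : B => bregman Ψ (gradΨ h) w (A h) + η * grad f (A h) (w - (A h : B)))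
      W (A (h ++ [f]))

end OnlineGame

open scoped Pointwise

/-!
A rate `V * m ^ (-1 / q)` for the linear game bounds random walks in the dual space, and these walks
yield, by convex conjugation, a uniformly convex regularizer for Mirror Descent.

*From the game to walks.* Consider walks in the dual space with steps `± d`, where `d ∈ X` may depend
on the past signs, and let `walkValue W X m x` be the largest expected value, after `m` steps from
`x`, of the support function of `W`. An adversary that follows an optimal walk, and always takes the
sign that is worse for the algorithm, makes the total regret of any algorithm as large as
`walkValue W X m 0` (`IsBoundedPair.exists_lt_of_lt_walkValue`). Hence
`walkValue W X m 0 ≤ V * m ^ (1 - 1 / q)`.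

*One scale.* If every step costs `ε`, then about `M = (2 * V / ε) ^ q` steps are unprofitable.
Conjugating `x ↦ min {2 * walkValue W X i x - ε * i : i ≤ M}` gives a convex function with values in
`[0, ε * M]` on `W`. The dynamic programming inequality
`(walkValue i (x + d) + walkValue i (x - d)) / 2 ≤ walkValue (i + 1) x` turns into a midpoint
inequality, in which the value at `(w + w') / 2` lies below the mean of the values at `w` and `w'` by
at least `‖w - w'‖ / 2 - ε`, where the norm is dual to the gauge of `X`
(`IsBoundedPair.scalePotential_midpoint_le`). The factor `2` leaves room to restrict the supremum to
a bounded set of functionals, so that the potential is finite and Lipschitz on the whole space.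

*All scales.* For `s > q` the potentials at the scales `ε = V / 2 ^ (j + 2)`, with weights of order
`ε ^ (s - 1)`, have a convergent sum, which is `s`-uniformly convex on `W` and at most
`(16 * V) ^ s / (s * (s - q))` there (`IsBoundedPair.exists_regularizer`).

*Mirror Descent.* By the Baire category theorem `W` contains a ball, and the dual norm dominates a
multiple of the norm of `B`; so minimizing sequences of the Mirror Descent steps are Cauchy and the
minimizers exist. Separating the strict epigraph from the set below the minimum provides subgradients
of `Ψ` on the whole space that satisfy the first-order condition on `W`. The usual telescoping of
Bregman divergences then gives regret `2 * κ` when `Ψ ≤ n * κ ^ s` on `W`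
(`exists_mirrorDescent_regret_le`). The exponent `s = q + 1 / log n` costs only a constant factor in
`n ^ (-1 / q)` and a factor `log n` in the size of `Ψ`, which the stated bound leaves ample room for.
-/

/-! ### Absorbing sets and the dual gauge -/

section Absorbing

/-- In a Banach space a closed, convex, symmetric and absorbing set is a neighbourhood of the
origin, by the Baire category theorem. -/
theorem exists_closedBall_subset_of_absorbent {E : Type*} [NormedAddCommGroup E]
    [NormedSpace ℝ E] [CompleteSpace E] {S : Set E} (hc : IsClosed S) (hconv : Convex ℝ S)
    (hsymm : ∀ x ∈ S, -x ∈ S) (habs : Absorbent ℝ S) :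
    ∃ ρ : ℝ, 0 < ρ ∧ Metric.closedBall (0 : E) ρ ⊆ S := by
  have hpos : ∀ k : ℕ, (k : ℝ) + 1 ≠ 0 := fun k => by positivity
  have hU : ⋃ k : ℕ, ((k : ℝ) + 1) • S = Set.univ := by
    refine Set.eq_univ_of_forall fun x => ?_
    obtain ⟨r, hr⟩ := (habs x).exists_pos
    obtain ⟨k, hk⟩ := exists_nat_ge r
    refine Set.mem_iUnion.2 ⟨k, ?_⟩
    have := hr.2 ((k : ℝ) + 1) (by
      rw [Real.norm_of_nonneg (by positivity)]; linarith)
    exact this rfl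
  obtain ⟨k, hk⟩ := nonempty_interior_of_iUnion_of_closed
    (fun k : ℕ => hc.smul_of_ne_zero (hpos k)) hU
  rw [interior_smul₀ (hpos k)] at hk
  obtain ⟨_, y, hy, -⟩ := hk
  have h0 : (0 : E) ∈ interior S := by
    have := hconv.combo_interior_self_mem_interior hy (hsymm y (interior_subset hy))
      (a := 1 / 2) (b := 1 / 2) (by norm_num) (by norm_num) (by norm_num)
    simpa using this
  obtain ⟨ρ, hρ, hsub⟩ := Metric.nhds_basis_closedBall.mem_iff.1 (mem_interior_iff_mem_nhds.1 h0)
  exact ⟨ρ, hρ, hsub⟩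

variable {B : Type*} [NormedAddCommGroup B] [NormedSpace ℝ B]

/-- If the elements of an absorbing set `X` of functionals are at most `b` at `δ`, then
`‖δ‖` is at most a constant (depending on `X` only) times `b`. -/
theorem exists_mul_norm_le_of_absorbent {X : Set (StrongDual ℝ B)} (hconv : Convex ℝ X)
    (hsymm : ∀ x ∈ X, -x ∈ X) (habs : Absorbent ℝ X) :
    ∃ ρ : ℝ, 0 < ρ ∧ ∀ (δ : B) (b : ℝ), (∀ x ∈ X, x δ ≤ b) → ρ * ‖δ‖ ≤ b := by
  obtain ⟨ρ, hρ, hsub⟩ := exists_closedBall_subset_of_absorbent (S := closure X) isClosed_closure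
    hconv.closure
    (fun x hx => map_mem_closure continuous_neg hx hsymm) (habs.mono subset_closure)
  refine ⟨ρ, hρ, fun δ b hb => ?_⟩
  have hcl : ∀ x ∈ closure X, x δ ≤ b := fun x hx =>
    closure_minimal (s := X) (t := {x | x δ ≤ b}) hb
      (isClosed_le (by fun_prop) continuous_const) hx
  obtain ⟨g, hg, hgδ⟩ := exists_dual_vector'' ℝ δ
  have := hcl (ρ • g) (hsub (by
    rw [mem_closedBall_zero_iff, norm_smul, Real.norm_of_nonneg hρ.le]
    nlinarith))
  simpa [hgδ] using this

theorem apply_le_of_gauge_le_one {X : Set (StrongDual ℝ B)} (hconv : Convex ℝ X)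
    (habs : Absorbent ℝ X) {δ : B} {b : ℝ} (hb : ∀ x ∈ X, x δ ≤ b) {x : StrongDual ℝ B}
    (hx : gauge X x ≤ 1) : x δ ≤ b := by
  have h0 : 0 ≤ b := by simpa using hb 0 habs.zero_mem
  by_contra! hlt
  have hpos : 0 < x δ := h0.trans_lt hlt
  obtain ⟨t, ht1, ht2⟩ := exists_between ((div_lt_one hpos).2 hlt)
  have htpos : 0 ≤ t := (div_nonneg h0 hpos.le).trans ht1.le
  have hmem : t • x ∈ X := by
    refine setOfPred_gauge_lt_one_subset_self hconv habs.zero_mem habs ?_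
    rw [Set.mem_ofPred_eq, gauge_smul_of_nonneg htpos, smul_eq_mul]
    nlinarith
  have := hb _ hmem
  rw [div_lt_iff₀ hpos] at ht1
  simp at this
  linarith

theorem dualGauge_le {X : Set (StrongDual ℝ B)} (hconv : Convex ℝ X)
    (habs : Absorbent ℝ X) {δ : B} {b : ℝ} (hb : ∀ x ∈ X, x δ ≤ b) : dualGauge X δ ≤ b :=
  have : Nonempty {x : StrongDual ℝ B // gauge X x ≤ 1} := ⟨⟨0, by simp⟩⟩
  ciSup_le fun x => apply_le_of_gauge_le_one hconv habs hb x.2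

theorem le_dualGauge {X : Set (StrongDual ℝ B)} (hconv : Convex ℝ X)
    (habs : Absorbent ℝ X) {δ : B} {b : ℝ} (hb : ∀ x ∈ X, x δ ≤ b) {x : StrongDual ℝ B}
    (hx : x ∈ X) : x δ ≤ dualGauge X δ :=
  le_ciSup (f := fun x : {x : StrongDual ℝ B // gauge X x ≤ 1} => (x : StrongDual ℝ B) δ)
    ⟨b, by rintro _ ⟨y, rfl⟩; exact apply_le_of_gauge_le_one hconv habs hb y.2⟩
    ⟨x, gauge_le_one_of_mem hx⟩

end Absorbing

/-! ### Regret as a family of real inequalities -/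

section Regret

theorem regret_le_iff {B : Type*} {W : Set B} (A : OnlineAlgorithm W) {n : ℕ} (hn : 0 < n)
    (f : Fin n → B → ℝ) (C : ℝ) :
    regret A f ≤ (C : EReal) ↔
      ∀ w ∈ W, ∑ t : Fin n, (f t (A ((List.ofFn f).take (t : ℕ)) : B) - f t w) ≤ n * C := by
  have hn' : (0 : ℝ) < n := by exact_mod_cast hn
  have key : ∀ a : ℝ, (a : EReal) - (⨅ w : W, (((1 / (n : ℝ)) * ∑ t : Fin n, f t (w : B) : ℝ) :
      EReal)) ≤ C ↔ ∀ w ∈ W, a - (1 / (n : ℝ)) * ∑ t : Fin n, f t w ≤ C := by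
    intro a
    rw [EReal.sub_le_iff_le_add (.inr (EReal.coe_ne_top C)) (.inr (EReal.coe_ne_bot C)), add_comm,
      ← EReal.sub_le_iff_le_add (.inl (EReal.coe_ne_bot C)) (.inl (EReal.coe_ne_top C)),
      ← EReal.coe_sub, le_iInf_iff, Subtype.forall]
    refine forall₂_congr fun w _ => ?_
    rw [EReal.coe_le_coe_iff]
    constructor <;> intro h <;> linarith
  rw [regret, key]
  refine forall₂_congr fun w _ => ?_
  rw [Finset.sum_sub_distrib, ← mul_sub, one_div, inv_mul_le_iff₀ hn']

end Regret

/-! ### Values of dyadic walks and the adversary -/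

section Walk

variable {B : Type*} [NormedAddCommGroup B] [NormedSpace ℝ B]

/-- The support function `x ↦ sup {⟨x, w⟩ : w ∈ W}` of `W`. -/
noncomputable def supportFn (W : Set B) (x : StrongDual ℝ B) : ℝ := ⨆ w : W, x w

/-- The largest expected value of `supportFn W` at the end of a walk of `i` steps that starts at `x`
and whose steps are `± d` with equal probability, where `d ∈ X` may depend on the past signs. -/
noncomputable def walkValue (W : Set B) (X : Set (StrongDual ℝ B)) : ℕ → StrongDual ℝ B → ℝ
  | 0 => supportFn W
  | i + 1 => fun x => ⨆ d : X, (walkValue W X i (x + d) + walkValue W X i (x - d)) / 2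

/-- The properties of the game that the potentials need: `W` is convex, `W` and `X` are symmetric and
contain the origin, the elements of `X` are at most `V` on `W`, and every functional is bounded
on `W`. -/
structure IsBoundedPair (W : Set B) (X : Set (StrongDual ℝ B)) (V : ℝ) : Prop where
  convex : Convex ℝ W
  neg_mem_left : ∀ w ∈ W, -w ∈ W
  zero_mem_left : 0 ∈ W
  neg_mem_right : ∀ x ∈ X, -x ∈ X
  zero_mem_right : 0 ∈ X
  apply_le : ∀ x ∈ X, ∀ w ∈ W, x w ≤ V
  bddAbove : ∀ x : StrongDual ℝ B, BddAbove (Set.range fun w : W => x w)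

namespace IsBoundedPair

variable {W : Set B} {X : Set (StrongDual ℝ B)} {V : ℝ}

theorem apply_le_supportFn (h : IsBoundedPair W X V) (x : StrongDual ℝ B) {w : B} (hw : w ∈ W) :
    x w ≤ supportFn W x :=
  le_ciSup (h.bddAbove x) ⟨w, hw⟩

theorem supportFn_le (h : IsBoundedPair W X V) {x : StrongDual ℝ B} {b : ℝ}
    (hb : ∀ w ∈ W, x w ≤ b) : supportFn W x ≤ b :=
  have : Nonempty W := ⟨⟨0, h.zero_mem_left⟩⟩
  ciSup_le fun w => hb w w.2

theorem supportFn_add_le (h : IsBoundedPair W X V) (x y : StrongDual ℝ B) :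
    supportFn W (x + y) ≤ supportFn W x + supportFn W y :=
  h.supportFn_le fun w hw => by
    simpa using add_le_add (h.apply_le_supportFn x hw) (h.apply_le_supportFn y hw)

theorem supportFn_neg (h : IsBoundedPair W X V) (x : StrongDual ℝ B) :
    supportFn W (-x) = supportFn W x := by
  have key : ∀ y : StrongDual ℝ B, supportFn W (-y) ≤ supportFn W y := fun y =>
    h.supportFn_le fun w hw => by
      simpa using h.apply_le_supportFn y (h.neg_mem_left w hw)
  exact le_antisymm (key x) (by simpa using key (-x))

theorem walkValue_le (h : IsBoundedPair W X V) (i : ℕ) (x : StrongDual ℝ B) :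
    walkValue W X i x ≤ supportFn W x + i * V := by
  induction i generalizing x with
  | zero => simp [walkValue]
  | succ i ih =>
    have : Nonempty X := ⟨⟨0, h.zero_mem_right⟩⟩
    refine ciSup_le fun d => ?_
    have h1 := ih (x + d)
    have h2 := ih (x - d)
    have h3 := h.supportFn_add_le x d
    have h4 := h.supportFn_add_le x (-d)
    have h5 : supportFn W (d : StrongDual ℝ B) ≤ V := h.supportFn_le (h.apply_le d d.2)
    rw [h.supportFn_neg, ← sub_eq_add_neg] at h4
    push_cast
    linarith

theorem add_div_two_le_walkValue (h : IsBoundedPair W X V) (i : ℕ) (x : StrongDual ℝ B)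
    {d : StrongDual ℝ B} (hd : d ∈ X) :
    (walkValue W X i (x + d) + walkValue W X i (x - d)) / 2 ≤ walkValue W X (i + 1) x := by
  refine le_ciSup (f := fun d : X => (walkValue W X i (x + d) + walkValue W X i (x - d)) / 2)
    ⟨supportFn W x + V + i * V, ?_⟩ ⟨d, hd⟩
  rintro _ ⟨e, rfl⟩
  have h1 := h.walkValue_le i (x + e)
  have h2 := h.walkValue_le i (x - e)
  have h3 := h.supportFn_add_le x e
  have h4 := h.supportFn_add_le x (-e)
  have h5 : supportFn W (e : StrongDual ℝ B) ≤ V := h.supportFn_le (h.apply_le e e.2)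
  rw [h.supportFn_neg, ← sub_eq_add_neg] at h4
  dsimp only
  linarith

theorem supportFn_le_walkValue (h : IsBoundedPair W X V) (i : ℕ) (x : StrongDual ℝ B) :
    supportFn W x ≤ walkValue W X i x := by
  induction i with
  | zero => exact le_rfl
  | succ i ih =>
    have := h.add_div_two_le_walkValue i x h.zero_mem_right
    simp only [add_zero, sub_zero, add_self_div_two] at this
    exact ih.trans this

theorem walkValue_neg (h : IsBoundedPair W X V) (i : ℕ) (x : StrongDual ℝ B) :
    walkValue W X i (-x) = walkValue W X i x := by
  induction i generalizing x with
  | zero => exact h.supportFn_neg x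
  | succ i ih =>
    refine iSup_congr fun d => ?_
    rw [← ih (-x + d), ← ih (-x - d), add_comm (walkValue W X i _)]
    congr 3 <;> abel

/-- The adversary's strategy: against any algorithm, linear costs can be chosen one after the other,
each time with the sign that is worse for the algorithm, so that the regret (after the linear
reward `x` has been added) exceeds any number below the value of the walk from `x`. -/
theorem exists_lt_of_lt_walkValue (h : IsBoundedPair W X V) (A : OnlineAlgorithm W) (m : ℕ)
    (hist : List (B → ℝ)) (x : StrongDual ℝ B) {c : ℝ} (hc : c < walkValue W X m x) :
    ∃ (d : Fin m → StrongDual ℝ B) (w : B), (∀ t, d t ∈ X) ∧ w ∈ W ∧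
      c < x w + ∑ t : Fin m,
        (d t (A (hist ++ (List.ofFn fun t => (fun u => d t u : B → ℝ)).take t) : B) - d t w) := by
  induction m generalizing hist x c with
  | zero =>
    have : Nonempty W := ⟨⟨0, h.zero_mem_left⟩⟩
    obtain ⟨w, hw⟩ := exists_lt_of_lt_ciSup (f := fun w : W => x w) hc
    exact ⟨Fin.elim0, w, fun t => t.elim0, w.2, by simpa using hw⟩
  | succ m ih =>
    have : Nonempty X := ⟨⟨0, h.zero_mem_right⟩⟩
    obtain ⟨d, hd⟩ := exists_lt_of_lt_ciSup
      (f := fun d : X => (walkValue W X m (x + d) + walkValue W X m (x - d)) / 2) hc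
    -- one of the two signs is at least as good as the average
    obtain ⟨e, heX, he⟩ : ∃ e ∈ X, c - e (A hist : B) < walkValue W X m (x - e) := by
      by_contra! hcon
      have h1 := hcon d d.2
      have h2 := hcon (-d) (h.neg_mem_right d d.2)
      simp only [sub_neg_eq_add, neg_apply] at h1 h2
      linarith
    obtain ⟨d', w, hd', hw, hlt⟩ := ih (hist ++ [fun u => e u]) (x - e) he
    refine ⟨Fin.cons e d', w, fun t => ?_, hw, ?_⟩
    · refine Fin.cases ?_ (fun t => ?_) t
      · simpa using heX
      · simpa using hd' t
    · rw [Fin.sum_univ_succ]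
      simp only [List.ofFn_succ, Fin.cons_zero, Fin.cons_succ, Fin.val_zero, List.take_zero,
        List.append_nil, Fin.val_succ, List.take_succ_cons, List.append_assoc, List.cons_append,
        List.nil_append, sub_apply] at hlt ⊢
      linarith

/-- The value of the walk from the origin is at most `m` times the value of the linear game. -/
theorem walkValue_zero_le_of_gameValue_le (h : IsBoundedPair W X V) {m : ℕ} (hm : 0 < m) {b : ℝ}
    (hb : gameValue W (linearCosts X) m ≤ (b : EReal)) : walkValue W X m 0 ≤ m * b := by
  have hm' : (0 : ℝ) < m := by exact_mod_cast hm
  refine le_of_forall_gt_imp_ge_of_dense fun c hc => ?_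
  have hlt : gameValue W (linearCosts X) m < ((c / m : ℝ) : EReal) :=
    hb.trans_lt (EReal.coe_lt_coe_iff.2 ((lt_div_iff₀' hm').2 hc))
  obtain ⟨A, hA⟩ := iInf_lt_iff.1 hlt
  by_contra! hcon
  obtain ⟨d, w, hd, hw, hcw⟩ := h.exists_lt_of_lt_walkValue A m [] 0 hcon
  have hreg := (le_iSup (fun f : Fin m → linearCosts X => regret A fun t => (f t : B → ℝ))
    fun t => ⟨fun u => d t u, d t, hd t, rfl⟩).trans hA.le
  have := (regret_le_iff A hm _ _).1 hreg w hw
  rw [mul_div_cancel₀ _ hm'.ne'] at this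
  simp only [List.nil_append, zero_apply, zero_add] at hcw
  linarith

end IsBoundedPair

/-- The one-round game bounds the elements of `X` on `W`. -/
theorem apply_le_of_gameValue_one_le {W : Set B} {X : Set (StrongDual ℝ B)}
    (hW : ∀ w ∈ W, -w ∈ W) (hX : ∀ x ∈ X, -x ∈ X) {b : ℝ}
    (hb : gameValue W (linearCosts X) 1 ≤ (b : EReal)) : ∀ x ∈ X, ∀ w ∈ W, x w ≤ b := by
  intro x hx w hw
  refine le_of_forall_gt_imp_ge_of_dense fun c hc => ?_
  obtain ⟨A, hA⟩ := iInf_lt_iff.1 (hb.trans_lt (EReal.coe_lt_coe_iff.2 hc))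
  have key : ∀ y ∈ X, ∀ u ∈ W, y (A [] : B) - y u ≤ c := fun y hy u hu => by
    have hreg := (le_iSup (fun f : Fin 1 → linearCosts X => regret A fun t => (f t : B → ℝ))
      fun t => ⟨fun u => y u, y, hy, rfl⟩).trans hA.le
    simpa using (regret_le_iff A one_pos _ _).1 hreg u hu
  have h1 := key x hx (-w) (hW w hw)
  have h2 := key (-x) (hX x hx) w hw
  simp only [map_neg, neg_apply, sub_neg_eq_add] at h1 h2
  linarith

end Walk

/-! ### The potential at one scale -/

section Potential

variable {B : Type*} [NormedAddCommGroup B] [NormedSpace ℝ B]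

/-- The potential at scale `ε`: the convex conjugate of
`x ↦ min {2 * walkValue W X i x - ε * i : i ≤ M}`, where only functionals `x` that are at most
`ε * M` on `W` compete. This restriction makes the potential finite and Lipschitz on the whole space
and does not change its values on `W`. -/
noncomputable def scalePotential (W : Set B) (X : Set (StrongDual ℝ B)) (ε : ℝ) (M : ℕ) (w : B) :
    ℝ :=
  ⨆ p : {x : StrongDual ℝ B // ∀ u ∈ W, x u ≤ ε * M} × Fin (M + 1),
    ((p.1 : StrongDual ℝ B) w - 2 * walkValue W X p.2 p.1 + ε * (p.2 : ℕ))

namespace IsBoundedPair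

variable {W : Set B} {X : Set (StrongDual ℝ B)} {V : ℝ}

theorem supportFn_nonneg (h : IsBoundedPair W X V) (x : StrongDual ℝ B) : 0 ≤ supportFn W x := by
  simpa using h.apply_le_supportFn x h.zero_mem_left

theorem walkValue_nonneg (h : IsBoundedPair W X V) (i : ℕ) (x : StrongDual ℝ B) :
    0 ≤ walkValue W X i x :=
  (h.supportFn_nonneg x).trans (h.supportFn_le_walkValue i x)

theorem walkValue_zero_zero (h : IsBoundedPair W X V) : walkValue W X 0 0 = 0 :=
  le_antisymm (h.supportFn_le (by simp)) (h.walkValue_nonneg 0 0)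

variable {ε r : ℝ} {M : ℕ}

theorem norm_le_of_closedBall_subset (hr : 0 < r) (hball : Metric.closedBall (0 : B) r ⊆ W)
    {x : StrongDual ℝ B} {b : ℝ} (hb : 0 ≤ b) (hx : ∀ u ∈ W, x u ≤ b) : ‖x‖ ≤ b / r := by
  have hle : ∀ u : B, x u ≤ b / r * ‖u‖ := by
    intro u
    rcases eq_or_ne u 0 with rfl | hu
    · simp
    have hu' : 0 < ‖u‖ := norm_pos_iff.2 hu
    have := hx ((r / ‖u‖) • u) (hball (by
      rw [mem_closedBall_zero_iff, norm_smul, norm_div, norm_norm, div_mul_cancel₀ _ hu'.ne',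
        Real.norm_of_nonneg hr.le]))
    rw [map_smul, smul_eq_mul, div_mul_eq_mul_div, div_le_iff₀ hu'] at this
    rw [div_mul_eq_mul_div, le_div_iff₀ hr]
    linarith
  refine x.opNorm_le_bound (by positivity) fun u => abs_le.2 ⟨?_, hle u⟩
  have := hle (-u)
  rw [map_neg, norm_neg] at this
  linarith

section

variable (h : IsBoundedPair W X V) (hε : 0 ≤ ε) (hr : 0 < r)
  (hball : Metric.closedBall (0 : B) r ⊆ W)
include h hε hr hball

theorem scalePotential_term_le (w : B)
    (p : {x : StrongDual ℝ B // ∀ u ∈ W, x u ≤ ε * M} × Fin (M + 1)) :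
    (p.1 : StrongDual ℝ B) w - 2 * walkValue W X p.2 p.1 + ε * (p.2 : ℕ) ≤
      ε * M / r * ‖w‖ + ε * M := by
  have h1 := norm_le_of_closedBall_subset hr hball (by positivity) p.1.2
  have h2 : (p.1 : StrongDual ℝ B) w ≤ ε * M / r * ‖w‖ :=
    (le_abs_self _).trans (((p.1 : StrongDual ℝ B).le_opNorm w).trans (by gcongr))
  have h3 := h.walkValue_nonneg p.2 p.1
  have h4 : ε * ((p.2 : ℕ) : ℝ) ≤ ε * M := by
    gcongr
    exact Nat.lt_succ_iff.1 p.2.2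
  linarith

theorem bddAbove_scalePotential (w : B) :
    BddAbove (Set.range fun p : {x : StrongDual ℝ B // ∀ u ∈ W, x u ≤ ε * M} × Fin (M + 1) =>
      (p.1 : StrongDual ℝ B) w - 2 * walkValue W X p.2 p.1 + ε * (p.2 : ℕ)) :=
  ⟨_, by rintro _ ⟨p, rfl⟩; exact h.scalePotential_term_le hε hr hball w p⟩

theorem le_scalePotential (w : B) {x : StrongDual ℝ B} (hx : ∀ u ∈ W, x u ≤ ε * M) {i : ℕ}
    (hi : i ≤ M) : x w - 2 * walkValue W X i x + ε * i ≤ scalePotential W X ε M w :=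
  le_ciSup (h.bddAbove_scalePotential hε hr hball w) (⟨x, hx⟩, ⟨i, Nat.lt_succ_iff.2 hi⟩)

omit h hr hball in
theorem scalePotential_le {w : B} {b : ℝ}
    (hb : ∀ x : StrongDual ℝ B, (∀ u ∈ W, x u ≤ ε * M) → ∀ i : ℕ, i ≤ M →
      x w - 2 * walkValue W X i x + ε * i ≤ b) : scalePotential W X ε M w ≤ b :=
  have : Nonempty {x : StrongDual ℝ B // ∀ u ∈ W, x u ≤ ε * M} :=
    ⟨⟨0, fun u _ => by simp only [zero_apply]; positivity⟩⟩
  ciSup_le fun p => hb p.1 p.1.2 p.2 (Nat.lt_succ_iff.1 p.2.2)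

theorem scalePotential_nonneg (w : B) : 0 ≤ scalePotential W X ε M w := by
  have := h.le_scalePotential hε hr hball (M := M) w (x := 0)
    (fun u _ => by simp only [zero_apply]; positivity) (Nat.zero_le M)
  simpa [h.walkValue_zero_zero] using this

theorem convexOn_scalePotential : ConvexOn ℝ Set.univ (scalePotential W X ε M) := by
  refine ⟨convex_univ, fun u _ v _ a b ha hb hab => scalePotential_le hε fun x hx i hi => ?_⟩
  have h1 := mul_le_mul_of_nonneg_left (h.le_scalePotential hε hr hball u hx hi) ha
  have h2 := mul_le_mul_of_nonneg_left (h.le_scalePotential hε hr hball v hx hi) hb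
  obtain rfl : b = 1 - a := by linarith
  simp only [map_add, map_smul, smul_eq_mul]
  linarith

theorem scalePotential_neg (w : B) : scalePotential W X ε M (-w) = scalePotential W X ε M w := by
  have key : ∀ v : B, scalePotential W X ε M (-v) ≤ scalePotential W X ε M v := fun v =>
    scalePotential_le hε fun x hx i hi => by
      have := h.le_scalePotential hε hr hball v (x := -x)
        (fun u hu => by simpa using hx (-u) (h.neg_mem_left u hu)) hi
      simpa [h.walkValue_neg] using this
  exact le_antisymm (key w) (by simpa using key (-w))

theorem scalePotential_zero_le (w : B) :
    scalePotential W X ε M 0 ≤ scalePotential W X ε M w := by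
  have := (h.convexOn_scalePotential hε hr hball (M := M)).2 (Set.mem_univ w) (Set.mem_univ (-w))
    (by norm_num : (0 : ℝ) ≤ 1 / 2) (by norm_num : (0 : ℝ) ≤ 1 / 2) (by norm_num)
  rw [h.scalePotential_neg hε hr hball, smul_neg, add_neg_cancel] at this
  simp only [smul_eq_mul] at this
  linarith

theorem scalePotential_sub_le (v w : B) :
    scalePotential W X ε M v - scalePotential W X ε M w ≤ ε * M / r * ‖v - w‖ := by
  rw [sub_le_iff_le_add]
  refine scalePotential_le hε fun x hx i hi => ?_
  have h1 := norm_le_of_closedBall_subset hr hball (by positivity) hx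
  have h2 : x (v - w) ≤ ε * M / r * ‖v - w‖ :=
    (le_abs_self _).trans ((x.le_opNorm _).trans (by gcongr))
  have h3 := h.le_scalePotential hε hr hball w hx hi
  rw [map_sub] at h2
  linarith

omit hr hball in
theorem scalePotential_le_mul {w : B} (hw : w ∈ W) : scalePotential W X ε M w ≤ ε * M := by
  refine scalePotential_le hε fun x _ i hi => ?_
  have h1 := h.apply_le_supportFn x hw
  have h2 := h.supportFn_le_walkValue i x
  have h3 := h.supportFn_nonneg x
  have h4 : ε * (i : ℝ) ≤ ε * M := by gcongr
  linarith

/-- On `W`, all functionals may compete: those excluded from the supremum contribute at most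
zero. -/
theorem le_scalePotential_of_mem {w : B} (hw : w ∈ W) (x : StrongDual ℝ B) {i : ℕ} (hi : i ≤ M) :
    x w - 2 * walkValue W X i x + ε * i ≤ scalePotential W X ε M w := by
  by_cases hx : ∀ u ∈ W, x u ≤ ε * M
  · exact h.le_scalePotential hε hr hball w hx hi
  · push Not at hx
    obtain ⟨u, hu, hlt⟩ := hx
    have h0 := h.scalePotential_nonneg hε hr hball (M := M) w
    have h1 := h.apply_le_supportFn x hw
    have h2 := h.supportFn_le_walkValue i x
    have h3 := h.apply_le_supportFn x hu
    have h4 : ε * (i : ℝ) ≤ ε * M := by gcongr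
    linarith

/-- Uniform convexity at scale `ε`. One step of the walk in the dual space, from `x` to `x ± d`,
becomes a gain of `d (w - w') / 2` at the midpoint of `w` and `w'`, up to the price `ε` of a
step. -/
theorem scalePotential_midpoint_le (hM : 0 < M) (hwalk : 2 * walkValue W X M 0 ≤ ε * M) {w w' : B}
    (hw : w ∈ W) (hw' : w' ∈ W) {d : StrongDual ℝ B} (hd : d ∈ X) :
    scalePotential W X ε M ((1 / 2 : ℝ) • w + (1 / 2 : ℝ) • w') ≤
      (scalePotential W X ε M w + scalePotential W X ε M w') / 2 + ε - d (w - w') / 2 := by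
  have step : ∀ x : StrongDual ℝ B, ∀ i : ℕ, i + 1 ≤ M →
      x ((1 / 2 : ℝ) • w + (1 / 2 : ℝ) • w') - 2 * walkValue W X (i + 1) x +
        ε * ((i + 1 : ℕ) : ℝ) ≤
      (scalePotential W X ε M w + scalePotential W X ε M w') / 2 + ε - d (w - w') / 2 := by
    intro x i hi
    have h1 := h.le_scalePotential_of_mem hε hr hball hw (x + d) (Nat.le_of_succ_le hi)
    have h2 := h.le_scalePotential_of_mem hε hr hball hw' (x - d) (Nat.le_of_succ_le hi)
    have h3 := h.add_div_two_le_walkValue i x hd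
    simp only [map_add, map_sub, map_smul, smul_eq_mul, add_apply, sub_apply] at h1 h2 ⊢
    push_cast
    linarith
  refine scalePotential_le hε fun x _ i hi => ?_
  rcases i with _ | i
  · -- the terms without a step are dominated by the term with `M` steps from the origin
    obtain ⟨k, rfl⟩ := Nat.exists_eq_succ_of_ne_zero hM.ne'
    have h1 := step 0 k (by omega)
    have h2 := h.apply_le_supportFn x (h.convex hw hw' (a := 1 / 2) (b := 1 / 2) (by norm_num)
      (by norm_num) (by norm_num))
    have h3 := h.supportFn_nonneg x
    simp only [Nat.succ_eq_add_one, zero_apply] at h1 hwalk ⊢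
    simp only [walkValue, CharP.cast_eq_zero, mul_zero, add_zero]
    linarith
  · exact step x i hi

end

end IsBoundedPair

end Potential

/-! ### The regularizer -/

section Regularizer

variable {B : Type*} [NormedAddCommGroup B] [NormedSpace ℝ B]

/-- Along a segment, a convex function whose midpoint value is `c` below the chord is
`2 * min α (1 - α) * c` below the chord at the point with weights `α` and `1 - α`. -/
theorem isUniformlyConvexOn_of_midpoint {W : Set B} {N : B → ℝ} {s : ℝ} {Ψ : B → ℝ} (hs : 0 < s)
    (hN : ∀ w, 0 ≤ N w) (hΨ : ConvexOn ℝ Set.univ Ψ)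
    (hmid : ∀ w ∈ W, ∀ w' ∈ W, Ψ ((1 / 2 : ℝ) • w + (1 / 2 : ℝ) • w') ≤
      (Ψ w + Ψ w') / 2 - N (w - w') ^ s / (2 * s)) :
    IsUniformlyConvexOn W N s Ψ := by
  rintro w hw w' hw' α ⟨hα0, hα1⟩
  have hm := hmid w hw w' hw'
  set m := (1 / 2 : ℝ) • w + (1 / 2 : ℝ) • w' with hmdef
  set D := N (w - w') ^ s / (2 * s) with hD
  have hD0 : 0 ≤ D := by have := Real.rpow_nonneg (hN (w - w')) s; positivity
  have hDs : α * (1 - α) / s * N (w - w') ^ s = 2 * (α * (1 - α)) * D := by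
    rw [hD]; field_simp
  rw [hDs]
  rcases le_total α (1 / 2) with hα | hα
  · have hc := hΨ.2 (Set.mem_univ m) (Set.mem_univ w') (by linarith : 0 ≤ 2 * α)
      (by linarith : 0 ≤ 1 - 2 * α) (by ring)
    have heq : (2 * α) • m + (1 - 2 * α) • w' = α • w + (1 - α) • w' := by
      rw [hmdef]; module
    rw [heq, smul_eq_mul, smul_eq_mul] at hc
    nlinarith [mul_le_mul_of_nonneg_left hm hα0, mul_nonneg (mul_nonneg hα0 hα0) hD0]
  · have hc := hΨ.2 (Set.mem_univ m) (Set.mem_univ w) (by linarith : 0 ≤ 2 * (1 - α))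
      (by linarith : 0 ≤ 1 - 2 * (1 - α)) (by ring)
    have heq : (2 * (1 - α)) • m + (1 - 2 * (1 - α)) • w = α • w + (1 - α) • w' := by
      rw [hmdef]; module
    rw [heq, smul_eq_mul, smul_eq_mul] at hc
    have hβ : 0 ≤ 1 - α := by linarith
    nlinarith [mul_le_mul_of_nonneg_left hm hβ, mul_nonneg (mul_nonneg hβ hβ) hD0]

/-- The number of steps for which a bound `V * m ^ (1 - 1 / q)` on the values of the walks makes
steps of price `ε` unprofitable. -/
theorem exists_steps {φ : ℕ → ℝ} {V q ε : ℝ} (hq : 1 ≤ q) (hε : 0 < ε) (hεV : ε ≤ 2 * V)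
    (hφ : ∀ m : ℕ, 0 < m → φ m ≤ m * (V * (m : ℝ) ^ (-(1 / q)))) :
    ∃ M : ℕ, 0 < M ∧ 2 * φ M ≤ ε * M ∧ ε * M ≤ 2 * ε * (2 * V / ε) ^ q := by
  have hone : 1 ≤ 2 * V / ε := (one_le_div hε).2 hεV
  have hone' : 1 ≤ (2 * V / ε) ^ q := Real.one_le_rpow hone (by linarith)
  have hle := Nat.le_ceil ((2 * V / ε) ^ q)
  have hlt := Nat.ceil_lt_add_one (zero_le_one.trans hone')
  set M := ⌈(2 * V / ε) ^ q⌉₊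
  have hM : (0 : ℝ) < M := by linarith
  refine ⟨M, by exact_mod_cast hM, ?_, by nlinarith⟩
  have hroot : 2 * V / ε ≤ (M : ℝ) ^ (1 / q) := by
    have := Real.rpow_le_rpow (by positivity) hle (by positivity : 0 ≤ 1 / q)
    rwa [← Real.rpow_mul (by linarith), mul_one_div_cancel (by linarith), Real.rpow_one] at this
  have hpos : 0 < (M : ℝ) ^ (1 / q) := Real.rpow_pos_of_pos hM _
  calc 2 * φ M ≤ 2 * (M * (V * (M : ℝ) ^ (-(1 / q)))) := by
        have := hφ M (by exact_mod_cast hM)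
        linarith
    _ = M * (2 * V / (M : ℝ) ^ (1 / q)) := by rw [Real.rpow_neg hM.le]; ring
    _ ≤ M * ε := by
        gcongr
        rw [div_le_iff₀ hpos]
        rw [div_le_iff₀ hε] at hroot
        linarith
    _ = ε * M := mul_comm _ _

/-- The contribution of the scale `V * τ` to the size of the regularizer. -/
theorem weight_mul_scale_eq {V q s τ : ℝ} (hV : 0 < V) (hs : 0 < s) (hτ : 0 < τ) :
    2 / s * (8 * (V * τ)) ^ (s - 1) * (2 * (V * τ) * (2 * V / (V * τ)) ^ q) =
      (8 * V) ^ s * 2 ^ q / (2 * s) * τ ^ (s - q) := by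
  have h1 : 2 * V / (V * τ) = 2 / τ := by field_simp
  have h2 : 8 * (V * τ) = (8 * V) * τ := by ring
  rw [h1, h2, Real.rpow_sub_one (by positivity), Real.mul_rpow (by positivity) hτ.le,
    Real.div_rpow (by norm_num) hτ.le, Real.rpow_sub hτ]
  have : 0 < τ ^ q := Real.rpow_pos_of_pos hτ q
  field_simp
  ring

namespace IsBoundedPair

variable {W : Set B} {X : Set (StrongDual ℝ B)} {V : ℝ}

/-- The regularizer is a weighted sum of the potentials at the scales `V / 2 ^ (j + 2)`. The weights
are such that the scale next to `dualGauge X (w - w')` alone gives the required uniform convexity,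
and since `s > q` the potentials add up to a convergent series. -/
theorem exists_regularizer (h : IsBoundedPair W X V) (hV : 0 < V) (hXconvex : Convex ℝ X)
    (hXabs : Absorbent ℝ X) {r : ℝ} (hr : 0 < r) (hball : Metric.closedBall (0 : B) r ⊆ W)
    {q s : ℝ} (hq : 2 ≤ q) (hqs : q < s) (hsq : s ≤ q + 1)
    (hwalk : ∀ m : ℕ, 0 < m → walkValue W X m 0 ≤ m * (V * (m : ℝ) ^ (-(1 / q)))) :
    ∃ Ψ : B → ℝ, ConvexOn ℝ Set.univ Ψ ∧ Continuous Ψ ∧ (∀ w, 0 ≤ Ψ w) ∧ Ψ 0 = 0 ∧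
      IsUniformlyConvexOn W (dualGauge X) s Ψ ∧
      ∀ w ∈ W, Ψ w ≤ (16 * V) ^ s / (s * (s - q)) := by
  have hs : 0 < s := by linarith
  have hhalf : ∀ j : ℕ, (0 : ℝ) < (1 / 2 : ℝ) ^ (j + 2) := fun j => by positivity
  have hhalf1 : ∀ j : ℕ, (1 / 2 : ℝ) ^ (j + 2) ≤ 1 := fun j =>
    pow_le_one₀ (by norm_num) (by norm_num)
  set ε : ℕ → ℝ := fun j => V * (1 / 2 : ℝ) ^ (j + 2) with hεdef
  have hε : ∀ j, 0 < ε j := fun j => mul_pos hV (hhalf j)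
  choose M hM hMwalk hMle using fun j => exists_steps (ε := ε j) (q := q) (by linarith) (hε j)
    (by nlinarith [hhalf1 j]) hwalk
  set a : ℕ → ℝ := fun j => 2 / s * (8 * ε j) ^ (s - 1) with hadef
  have ha : ∀ j, 0 < a j := fun j => by
    have := Real.rpow_pos_of_pos (mul_pos (by norm_num : (0 : ℝ) < 8) (hε j)) (s - 1)
    positivity
  -- the total weight decays geometrically in `j`
  set ρ : ℝ := (1 / 2 : ℝ) ^ (s - q) with hρdef
  have hρ0 : 0 < ρ := Real.rpow_pos_of_pos (by norm_num) _
  have hρle : ρ ≤ 1 - (s - q) / 2 := by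
    have := rpow_one_add_le_one_add_mul_self (s := -1 / 2) (by norm_num) (p := s - q)
      (by linarith) (by linarith)
    norm_num at this
    rw [hρdef]
    norm_num
    linarith
  have hρ1 : ρ < 1 := by linarith
  have hT : ∀ j, a j * (ε j * M j) ≤ (16 * V) ^ s / (2 * s) * ρ ^ j := by
    intro j
    have hτ : ((1 / 2 : ℝ) ^ (j + 2)) ^ (s - q) ≤ ρ ^ j := by
      rw [← Real.rpow_natCast, ← Real.rpow_mul (by norm_num), mul_comm,
        Real.rpow_mul (by norm_num), Real.rpow_natCast]
      exact pow_le_pow_of_le_one hρ0.le hρ1.le (by omega)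
    have h2 : (2 : ℝ) ^ q ≤ 2 ^ s := Real.rpow_le_rpow_of_exponent_le (by norm_num) hqs.le
    calc a j * (ε j * M j) ≤ a j * (2 * ε j * (2 * V / ε j) ^ q) :=
          mul_le_mul_of_nonneg_left (hMle j) (ha j).le
      _ = (8 * V) ^ s * 2 ^ q / (2 * s) * ((1 / 2 : ℝ) ^ (j + 2)) ^ (s - q) :=
          weight_mul_scale_eq hV hs (hhalf j)
      _ ≤ (8 * V) ^ s * 2 ^ s / (2 * s) * ρ ^ j := by gcongr
      _ = (16 * V) ^ s / (2 * s) * ρ ^ j := by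
          rw [← Real.mul_rpow (by positivity) (by norm_num)]
          ring_nf
  have hTsum : Summable fun j => (16 * V) ^ s / (2 * s) * ρ ^ j :=
    (summable_geometric_of_lt_one hρ0.le hρ1).mul_left _
  have hTtsum : ∑' j, (16 * V) ^ s / (2 * s) * ρ ^ j ≤ (16 * V) ^ s / (s * (s - q)) := by
    rw [tsum_mul_left, tsum_geometric_of_lt_one hρ0.le hρ1]
    have hsq' : 0 < s - q := by linarith
    calc (16 * V) ^ s / (2 * s) * (1 - ρ)⁻¹ ≤ (16 * V) ^ s / (2 * s) * ((s - q) / 2)⁻¹ := by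
          gcongr
          linarith
      _ = _ := by field_simp
  set T : ℕ → ℝ := fun j => (16 * V) ^ s / (2 * s) * ρ ^ j
  set ψ : ℕ → B → ℝ := fun j => scalePotential W X (ε j) (M j) with hψdef
  set g : ℕ → B → ℝ := fun j w => a j * (ψ j w - ψ j 0) with hgdef
  have hg0 : ∀ j w, 0 ≤ g j w := fun j w =>
    mul_nonneg (ha j).le (sub_nonneg.2 (h.scalePotential_zero_le (hε j).le hr hball w))
  have hgsub : ∀ j v w, g j v - g j w ≤ T j * (‖v - w‖ / r) := by
    intro j v w
    have h1 := h.scalePotential_sub_le (hε j).le hr hball (M := M j) v w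
    calc g j v - g j w = a j * (ψ j v - ψ j w) := by simp only [hgdef]; ring
      _ ≤ a j * (ε j * M j / r * ‖v - w‖) := mul_le_mul_of_nonneg_left h1 (ha j).le
      _ = a j * (ε j * M j) * (‖v - w‖ / r) := by ring
      _ ≤ T j * (‖v - w‖ / r) := mul_le_mul_of_nonneg_right (hT j) (by positivity)
  have hgzero : ∀ j, g j 0 = 0 := fun j => by simp [hgdef]
  have hgsum : ∀ w, Summable fun j => g j w := fun w =>
    Summable.of_nonneg_of_le (fun j => hg0 j w)
      (fun j => by simpa [hgzero] using hgsub j w 0) (hTsum.mul_right (‖w‖ / r))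
  have hgconv : ∀ j, ConvexOn ℝ Set.univ (g j) := by
    intro j
    have h1 := (h.convexOn_scalePotential (hε j).le hr hball (M := M j))
    refine ⟨convex_univ, fun u hu v hv x y hx hy hxy => ?_⟩
    have h2 := mul_le_mul_of_nonneg_left (h1.2 hu hv hx hy hxy) (ha j).le
    obtain rfl : y = 1 - x := by linarith
    simp only [hgdef, hψdef, smul_eq_mul] at h2 ⊢
    linarith
  have hconv : ConvexOn ℝ Set.univ fun w => ∑' j, g j w := by
    refine ⟨convex_univ, fun u hu v hv x y hx hy hxy => ?_⟩
    simp only [smul_eq_mul]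
    rw [← tsum_mul_left, ← tsum_mul_left,
      ← ((hgsum u).mul_left x).tsum_add ((hgsum v).mul_left y)]
    exact (hgsum _).tsum_le_tsum (fun j => (hgconv j).2 hu hv hx hy hxy)
      (((hgsum u).mul_left x).add ((hgsum v).mul_left y))
  have hsub : ∀ v w, ∑' j, g j v - ∑' j, g j w ≤ (∑' j, T j) * (‖v - w‖ / r) := by
    intro v w
    rw [← (hgsum v).tsum_sub (hgsum w), ← tsum_mul_right]
    exact ((hgsum v).sub (hgsum w)).tsum_le_tsum (fun j => hgsub j v w) (hTsum.mul_right _)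
  have hT0 : 0 ≤ ∑' j, T j := tsum_nonneg fun j => by
    have : 0 ≤ (16 * V) ^ s := Real.rpow_nonneg (by positivity) s
    positivity
  have hdual : ∀ δ : B, ∃ b, ∀ x ∈ X, x δ ≤ b := fun δ =>
    ⟨V / r * ‖δ‖, fun x hx => (le_abs_self _).trans ((x.le_opNorm δ).trans
      (mul_le_mul_of_nonneg_right (norm_le_of_closedBall_subset hr hball hV.le (h.apply_le x hx))
        (norm_nonneg δ)))⟩
  have hNnonneg : ∀ δ : B, 0 ≤ dualGauge X δ := fun δ => by
    obtain ⟨b, hb⟩ := hdual δ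
    simpa using le_dualGauge hXconvex hXabs hb h.zero_mem_right
  refine ⟨fun w => ∑' j, g j w, hconv, ?_, fun w => tsum_nonneg fun j => hg0 j w, by simp [hgzero],
    isUniformlyConvexOn_of_midpoint hs hNnonneg hconv ?_, fun w hw => ?_⟩
  · refine (LipschitzWith.of_dist_le_mul (K := Real.toNNReal ((∑' j, T j) / r))
      fun v w => ?_).continuous
    rw [Real.coe_toNNReal _ (by positivity), Real.dist_eq, dist_eq_norm]
    have h1 := hsub v w
    have h2 := hsub w v
    rw [norm_sub_rev] at h2
    rw [abs_le, div_mul_eq_mul_div, ← mul_div_assoc] at *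
    constructor <;> linarith
  · intro w hw w' hw'
    set N := dualGauge X (w - w') with hN
    -- the gain of the whole series at the midpoint is at least the gain at any one scale
    have hone : ∀ j, g j ((1 / 2 : ℝ) • w + (1 / 2 : ℝ) • w') ≤
        (g j w + g j w') / 2 - a j * (N / 2 - ε j) := by
      intro j
      have h1 : N ≤ 2 * ((ψ j w + ψ j w') / 2 + ε j -
          ψ j ((1 / 2 : ℝ) • w + (1 / 2 : ℝ) • w')) :=
        dualGauge_le hXconvex hXabs fun d hd => by
          have := h.scalePotential_midpoint_le (hε j).le hr hball (hM j) (hMwalk j) hw hw' hd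
          linarith
      have h2 := mul_le_mul_of_nonneg_left h1 (ha j).le
      simp only [hgdef]
      linarith
    have hgap : ∀ j, 0 ≤ (g j w + g j w') / 2 - g j ((1 / 2 : ℝ) • w + (1 / 2 : ℝ) • w') := by
      intro j
      have := (hgconv j).2 (Set.mem_univ w) (Set.mem_univ w')
        (by norm_num : (0 : ℝ) ≤ 1 / 2) (by norm_num : (0 : ℝ) ≤ 1 / 2) (by norm_num)
      simp only [smul_eq_mul] at this
      linarith
    have hgapsum : HasSum
        (fun j => (g j w + g j w') / 2 - g j ((1 / 2 : ℝ) • w + (1 / 2 : ℝ) • w'))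
        ((∑' j, g j w + ∑' j, g j w') / 2 -
          ∑' j, g j ((1 / 2 : ℝ) • w + (1 / 2 : ℝ) • w')) :=
      (((hgsum w).hasSum.add (hgsum w').hasSum).div_const 2).sub (hgsum _).hasSum
    have hle : ∀ j, (g j w + g j w') / 2 - g j ((1 / 2 : ℝ) • w + (1 / 2 : ℝ) • w') ≤
        (∑' j, g j w + ∑' j, g j w') / 2 -
          ∑' j, g j ((1 / 2 : ℝ) • w + (1 / 2 : ℝ) • w') := fun j =>
      le_hasSum hgapsum j fun i _ => hgap i
    rcases (hNnonneg (w - w')).eq_or_lt with h0 | hpos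
    · rw [← hN] at h0
      rw [← h0, Real.zero_rpow hs.ne', zero_div]
      have := (hgap 0).trans (hle 0)
      linarith
    · rw [← hN] at hpos
      have hN2 : N ≤ 2 * V := dualGauge_le hXconvex hXabs fun x hx => by
        have h1 := h.apply_le x hx w hw
        have h2 := h.apply_le x hx (-w') (h.neg_mem_left w' hw')
        rw [map_neg] at h2
        rw [map_sub]
        linarith
      -- pick the scale with `4 * ε j < N ≤ 8 * ε j`
      obtain ⟨j, hj1, hj2⟩ := exists_nat_pow_near_of_lt_one (x := N / (2 * V)) (y := 1 / 2)
        (div_pos hpos (by linarith)) ((div_le_one (by linarith)).2 hN2) (by norm_num)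
        (by norm_num)
      rw [lt_div_iff₀ (by linarith)] at hj1
      rw [div_le_iff₀ (by linarith)] at hj2
      have h4 : 4 * ε j ≤ N := by
        simp only [hεdef, pow_succ] at hj1 ⊢
        linarith
      have h8 : N ≤ 8 * ε j := by
        simp only [hεdef, pow_succ] at hj2 ⊢
        linarith
      have hpow : N ^ (s - 1) ≤ (8 * ε j) ^ (s - 1) :=
        Real.rpow_le_rpow hpos.le h8 (by linarith)
      have hgain : N ^ s / (2 * s) ≤ a j * (N / 2 - ε j) :=
        calc N ^ s / (2 * s) = 2 / s * N ^ (s - 1) * (N / 4) := by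
              rw [Real.rpow_sub_one hpos.ne']; field_simp; ring
          _ ≤ 2 / s * (8 * ε j) ^ (s - 1) * (N / 4) := by gcongr
          _ ≤ a j * (N / 2 - ε j) :=
              mul_le_mul_of_nonneg_left (by linarith) (ha j).le
      have h5 := hone j
      have h6 := hle j
      linarith
  · refine le_trans ((hgsum w).tsum_le_tsum (fun j => ?_) hTsum) hTtsum
    refine le_trans (mul_le_mul_of_nonneg_left ?_ (ha j).le) (hT j)
    have h1 := h.scalePotential_nonneg (hε j).le hr hball (M := M j) 0
    have h2 := h.scalePotential_le_mul (hε j).le (M := M j) hw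
    simp only [hψdef]
    linarith

end IsBoundedPair

end Regularizer

/-! ### Mirror Descent -/

section MirrorDescent

variable {B : Type*} [NormedAddCommGroup B] [NormedSpace ℝ B]

/-- A first-order optimality condition: at a minimizer `u` over `W` of `Ψ - ℓ` there is a
subgradient `θ` of `Ψ`, as a function on the whole space, for which `θ - ℓ` is minimal at `u` over
`W`. -/
theorem exists_subgradient_of_isMinOn {W : Set B} (hW : Convex ℝ W) {Ψ : B → ℝ}
    (hΨ : ConvexOn ℝ Set.univ Ψ) (hcont : Continuous Ψ) (l : StrongDual ℝ B) {u : B} (hu : u ∈ W)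
    (hmin : ∀ w ∈ W, Ψ u - l u ≤ Ψ w - l w) :
    ∃ θ : StrongDual ℝ B, IsSubgradientOn Set.univ Ψ u θ ∧ ∀ w ∈ W, 0 ≤ (θ - l) (w - u) := by
  -- separate the strict epigraph of `Ψ - l` from the set of points of `W × ℝ` below the minimum
  obtain ⟨F, c, hF1, hF2⟩ := geometric_hahn_banach_open
    (s := {p : B × ℝ | Ψ p.1 - l p.1 < p.2}) (t := {p : B × ℝ | p.1 ∈ W ∧ p.2 ≤ Ψ u - l u})
    (by
      rintro ⟨v, a⟩ hv ⟨w, b⟩ hw x y hx hy hxy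
      have h1 := hΨ.2 (Set.mem_univ v) (Set.mem_univ w) hx hy hxy
      simp only [Set.mem_ofPred_eq, smul_eq_mul, Prod.fst_add, Prod.smul_fst, Prod.snd_add,
        Prod.smul_snd, map_add, map_smul] at hv hw h1 ⊢
      rcases hx.eq_or_lt with rfl | hx
      · obtain rfl : y = 1 := by linarith
        linarith
      · nlinarith)
    (isOpen_lt (by fun_prop) (by fun_prop))
    (by
      rintro ⟨v, a⟩ ⟨hv, ha⟩ ⟨w, b⟩ ⟨hw, hb⟩ x y hx hy hxy
      refine ⟨hW hv hw hx hy hxy, ?_⟩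
      simp only [Prod.snd_add, Prod.smul_snd, smul_eq_mul] at ha hb ⊢
      obtain rfl : y = 1 - x := by linarith
      nlinarith)
    (by
      rw [Set.disjoint_left]
      rintro ⟨v, a⟩ hv ⟨hvW, ha⟩
      have := hmin v hvW
      simp only [Set.mem_ofPred_eq] at hv ha
      linarith)
  have hsplit : ∀ (w : B) (t : ℝ), F (w, t) = F (w, 0) + t * F (0, 1) := by
    intro w t
    rw [← smul_eq_mul, ← map_smul, ← map_add]
    simp
  set κ := -F (0, 1) with hκ
  have hκpos : 0 < κ := by
    have h1 := hF1 (u, Ψ u - l u + 1) (by simp)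
    have h2 := hF2 (u, Ψ u - l u) ⟨hu, le_rfl⟩
    rw [hsplit] at h1 h2
    linarith
  set g : StrongDual ℝ B := κ⁻¹ • F.comp (ContinuousLinearMap.inl ℝ B ℝ) with hg
  have hgF : ∀ w, F (w, 0) = κ * g w := fun w => by
    simp [hg, mul_inv_cancel_left₀ hκpos.ne']
  have key : ∀ w, ∀ v ∈ W, g w - (Ψ w - l w) ≤ g v - (Ψ u - l u) := by
    intro w v hv
    have hlt : ∀ t, Ψ w - l w < t → κ * (g w - t) ≤ κ * (g v - (Ψ u - l u)) := by
      intro t ht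
      have h1 := hF1 (w, t) ht
      have h2 := hF2 (v, Ψ u - l u) ⟨hv, le_rfl⟩
      rw [hsplit, hgF] at h1 h2
      have h3 : F (0, 1) = -κ := by rw [hκ]; ring
      rw [h3] at h1 h2
      linarith
    have : ∀ t, Ψ w - l w < t → g w - (g v - (Ψ u - l u)) ≤ t := fun t ht => by
      have := le_of_mul_le_mul_left (hlt t ht) hκpos
      linarith
    have := le_of_forall_gt_imp_ge_of_dense this
    linarith
  refine ⟨g + l, fun w _ => ?_, fun w hw => ?_⟩
  · have := key w u hu
    simp only [add_apply, map_sub]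
    linarith
  · have := key u w hw
    simp only [add_sub_cancel_right, map_sub]
    linarith

/-- Minimizing sequences are Cauchy by uniform convexity. -/
theorem exists_isMinOn_sub [CompleteSpace B] {W : Set B} (hWc : IsClosed W) (hW : Convex ℝ W)
    (hne : W.Nonempty) {Ψ : B → ℝ} (hcont : Continuous Ψ) {N : B → ℝ} {s ρ : ℝ}
    (hs : 0 < s) (hρ : 0 < ρ) (hN : ∀ w, ρ * ‖w‖ ≤ N w) (huc : IsUniformlyConvexOn W N s Ψ)
    (l : StrongDual ℝ B) (hbdd : BddBelow ((fun w => Ψ w - l w) '' W)) :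
    ∃ u ∈ W, ∀ w ∈ W, Ψ u - l u ≤ Ψ w - l w := by
  set f : B → ℝ := fun w => Ψ w - l w with hf
  set I := sInf (f '' W) with hI
  have hle : ∀ w ∈ W, I ≤ f w := fun w hw => csInf_le hbdd ⟨w, hw, rfl⟩
  have hex : ∀ k : ℕ, ∃ w ∈ W, f w < I + 1 / ((k : ℝ) + 1) := fun k => by
    obtain ⟨_, ⟨w, hw, rfl⟩, hlt⟩ := exists_lt_of_csInf_lt (hne.image f)
      (lt_add_of_pos_right I (Nat.one_div_pos_of_nat (α := ℝ) (n := k)))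
    exact ⟨w, hw, hlt⟩
  choose u huW hu using hex
  have hdist : ∀ i j K : ℕ, K ≤ i → K ≤ j →
      dist (u i) (u j) ≤ (4 * s * (1 / ((K : ℝ) + 1))) ^ (1 / s) / ρ := by
    intro i j K hi hj
    have h1 := huc (u i) (huW i) (u j) (huW j) (1 / 2) (by norm_num)
    have h2 := hle _ (hW (huW i) (huW j) (by norm_num : (0 : ℝ) ≤ 1 / 2)
      (by norm_num : (0 : ℝ) ≤ 1 - 1 / 2) (by norm_num))
    have h3 : f (u i) < I + 1 / ((K : ℝ) + 1) :=
      (hu i).trans_le (by gcongr)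
    have h4 : f (u j) < I + 1 / ((K : ℝ) + 1) :=
      (hu j).trans_le (by gcongr)
    simp only [hf, map_add, map_smul, smul_eq_mul] at h2 h3 h4
    have h0 : 0 ≤ N (u i - u j) := le_trans (by positivity) (hN _)
    have h5 : N (u i - u j) ^ s ≤ 4 * s * (1 / ((K : ℝ) + 1)) := by
      have h6 : 1 / 2 * (1 - 1 / 2) / s * N (u i - u j) ^ s ≤ 1 / ((K : ℝ) + 1) := by linarith
      have h7 := mul_le_mul_of_nonneg_left h6 (by positivity : 0 ≤ 4 * s)
      have h8 : 4 * s * (1 / 2 * (1 - 1 / 2) / s * N (u i - u j) ^ s) = N (u i - u j) ^ s := by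
        field_simp
        norm_num
      rwa [h8] at h7
    have h9 : N (u i - u j) ≤ (4 * s * (1 / ((K : ℝ) + 1))) ^ (1 / s) := by
      have := Real.rpow_le_rpow (by positivity) h5 (by positivity : 0 ≤ 1 / s)
      rwa [← Real.rpow_mul h0, mul_one_div_cancel hs.ne', Real.rpow_one] at this
    rw [dist_eq_norm, le_div_iff₀ hρ, mul_comm]
    exact (hN _).trans h9
  have hlim : Filter.Tendsto (fun K : ℕ => (4 * s * (1 / ((K : ℝ) + 1))) ^ (1 / s) / ρ)
      Filter.atTop (nhds 0) := by
    have h1 := (tendsto_one_div_add_atTop_nhds_zero_nat (𝕜 := ℝ)).const_mul (4 * s)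
    have h2 := (h1.rpow_const (p := 1 / s) (Or.inr (by positivity))).div_const ρ
    simpa [Real.zero_rpow (inv_pos.2 hs).ne'] using h2
  obtain ⟨v, hv⟩ := cauchySeq_tendsto_of_complete
    (cauchySeq_of_le_tendsto_0 _ (fun i j K => hdist i j K) hlim)
  have hvW : v ∈ W := hWc.mem_of_tendsto hv (Filter.Eventually.of_forall huW)
  refine ⟨v, hvW, fun w hw => le_trans ?_ (hle w hw)⟩
  have hfc : Continuous f := hcont.sub l.continuous
  have h1 : Filter.Tendsto (fun k : ℕ => I + 1 / ((k : ℝ) + 1)) Filter.atTop (nhds (I + 0)) :=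
    (tendsto_one_div_add_atTop_nhds_zero_nat (𝕜 := ℝ)).const_add I
  rw [add_zero] at h1
  exact le_of_tendsto_of_tendsto' ((hfc.tendsto v).comp hv) h1 fun k => (hu k).le

/-- Uniform convexity bounds the Bregman divergence from below. -/
theorem rpow_div_le_bregman {W : Set B} {N : B → ℝ} {s : ℝ} {Ψ : B → ℝ}
    (huc : IsUniformlyConvexOn W N s Ψ) {w u : B} (hw : w ∈ W) (hu : u ∈ W) {θ : StrongDual ℝ B}
    (hθ : IsSubgradientOn Set.univ Ψ u θ) : N (w - u) ^ s / s ≤ bregman Ψ θ w u := by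
  -- compare the subgradient inequality and the convexity inequality at `α • w + (1 - α) • u` as
  -- `α` tends to zero
  have hα : ∀ α ∈ Set.Ioo (0 : ℝ) 1, (1 - α) * (N (w - u) ^ s / s) ≤ bregman Ψ θ w u := by
    rintro α ⟨h0, h1⟩
    have h2 := huc w hw u hu α ⟨h0.le, h1.le⟩
    have h3 := hθ (α • w + (1 - α) • u) (Set.mem_univ _)
    have h4 : α • w + (1 - α) • u - u = α • (w - u) := by module
    rw [h4, map_smul, smul_eq_mul] at h3
    refine le_of_mul_le_mul_left ?_ h0
    have h5 : α * (1 - α) / s * N (w - u) ^ s = α * ((1 - α) * (N (w - u) ^ s / s)) := by ring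
    rw [bregman]
    linarith
  have hlim : Filter.Tendsto (fun α : ℝ => (1 - α) * (N (w - u) ^ s / s))
      (nhdsWithin 0 (Set.Ioi 0)) (nhds ((1 - 0) * (N (w - u) ^ s / s))) :=
    (Continuous.tendsto (by fun_prop) 0).mono_left nhdsWithin_le_nhds
  rw [sub_zero, one_mul] at hlim
  exact le_of_tendsto hlim (Filter.eventually_of_mem (Ioo_mem_nhdsGT one_pos) hα)

/-- The one-step inequality of Mirror Descent: the change of the divergence from a competitor `w`
pays for the regret of a step from `u` to `u'`, up to `η ^ p / p`. -/
theorem mirrorDescent_step_le {W : Set B} {N : B → ℝ} {s p η : ℝ} {Ψ : B → ℝ}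
    (hps : p.HolderConjugate s) (hη : 0 ≤ η)
    (huc : IsUniformlyConvexOn W N s Ψ) {w u u' : B} (hu : u ∈ W) (hu' : u' ∈ W)
    {θ θ' g : StrongDual ℝ B} (hθ : IsSubgradientOn Set.univ Ψ u θ) (hN0 : 0 ≤ N (u' - u))
    (hg : (-g) (u' - u) ≤ N (u' - u)) (hopt : 0 ≤ (θ' - (θ - η • g)) (w - u')) :
    η * g (u - w) ≤ bregman Ψ θ w u - bregman Ψ θ' w u' + η ^ p / p := by
  have h1 := rpow_div_le_bregman huc hu' hu hθ
  have h2 := Real.young_inequality_of_nonneg hη hN0 hps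
  have h3 := mul_le_mul_of_nonneg_left hg hη
  simp only [bregman, map_sub, sub_apply, neg_apply, smul_apply, smul_eq_mul] at *
  linarith

/-- Mirror Descent with a uniformly convex regularizer `Ψ` that is at most `n * κ ^ s` on `W`, and
with step size `κ ^ (s - 1)`: it can be run, and its regret after `n` rounds is at most `2 * κ`. -/
theorem exists_mirrorDescent_regret_le [CompleteSpace B] {W : Set B} (hWc : IsClosed W)
    (hW : Convex ℝ W) (hW0 : (0 : B) ∈ W) {X : Set (StrongDual ℝ B)} (hX : ∀ x ∈ X, -x ∈ X)
    {Ψ : B → ℝ} (hΨ : ConvexOn ℝ Set.univ Ψ) (hcont : Continuous Ψ) (hnonneg : ∀ w, 0 ≤ Ψ w)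
    (hΨ0 : Ψ 0 = 0) {N : B → ℝ} {s ρ κ : ℝ} (hs : 1 < s) (hρ : 0 < ρ) (hN : ∀ w, ρ * ‖w‖ ≤ N w)
    (hXN : ∀ x ∈ X, ∀ w, x w ≤ N w) (huc : IsUniformlyConvexOn W N s Ψ)
    (hbdd : ∀ x : StrongDual ℝ B, BddAbove (Set.range fun w : W => x w)) {n : ℕ} (hn : 0 < n)
    (hκ : 0 < κ) (hle : ∀ w ∈ W, Ψ w ≤ n * κ ^ s) (grad : (B → ℝ) → B → StrongDual ℝ B)
    (hgrad : IsSubgradientOracle W X grad) :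
    ∃ (A : OnlineAlgorithm W) (gradΨ : List (B → ℝ) → StrongDual ℝ B),
      IsMirrorDescent X Ψ (κ ^ (s - 1)) grad gradΨ A ∧
      ∀ f : Fin n → B → ℝ, (∀ t, f t ∈ convexCosts W X) →
        regret A f ≤ ((2 * κ : ℝ) : EReal) := by
  set η := κ ^ (s - 1) with hη
  have hηpos : 0 < η := Real.rpow_pos_of_pos hκ _
  have hs0 : 0 < s := by linarith
  have hex : ∀ (S : W × StrongDual ℝ B) (f : B → ℝ), ∃ S' : W × StrongDual ℝ B,
      (∀ w ∈ W, Ψ S'.1 - (S.2 - η • grad f S.1) S'.1 ≤ Ψ w - (S.2 - η • grad f S.1) w) ∧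
      IsSubgradientOn Set.univ Ψ S'.1 S'.2 ∧
      ∀ w ∈ W, 0 ≤ (S'.2 - (S.2 - η • grad f S.1)) (w - S'.1) := by
    intro S f
    set l := S.2 - η • grad f S.1
    obtain ⟨b, hb⟩ := hbdd l
    obtain ⟨u, hu, hmin⟩ := exists_isMinOn_sub hWc hW ⟨0, hW0⟩ hcont hs0 hρ hN huc l
      ⟨-b, by
        rintro _ ⟨w, hw, rfl⟩
        have h1 := hnonneg w
        have h2 : l w ≤ b := hb ⟨⟨w, hw⟩, rfl⟩
        dsimp only
        linarith⟩
    obtain ⟨θ, h1, h2⟩ := exists_subgradient_of_isMinOn hW hΨ hcont l hu hmin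
    exact ⟨⟨⟨u, hu⟩, θ⟩, hmin, h1, h2⟩
  choose next hnext1 hnext2 hnext3 using hex
  -- the decision and the subgradient of `Ψ` are computed together along the history
  set state : List (B → ℝ) → W × StrongDual ℝ B :=
    fun h => h.foldl next (⟨0, hW0⟩, 0) with hstate
  have hsucc : ∀ h f, state (h ++ [f]) = next (state h) f := fun h f => by simp [hstate]
  have hsub : ∀ h, IsSubgradientOn Set.univ Ψ (state h).1 (state h).2 := by
    intro h
    rcases List.eq_nil_or_concat h with rfl | ⟨h, f, rfl⟩
    · intro u _
      simpa [hstate, hΨ0] using hnonneg u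
    · rw [List.concat_eq_append, hsucc]
      exact hnext2 _ _
  refine ⟨fun h => (state h).1, fun h => (state h).2, ⟨fun h _ => hsub h, fun w _ => ?_,
    fun h _ f _ w hw => ?_⟩, fun f hf => (regret_le_iff _ hn f _).2 fun w hw => ?_⟩
  · simpa [hstate, hΨ0] using hnonneg w
  · have := hnext1 (state h) f w hw
    simp only [hsucc, bregman, map_sub, Set.mem_ofPred_eq, sub_apply, smul_apply, smul_eq_mul]
      at this ⊢
    linarith
  · have hps : (Real.conjExponent s).HolderConjugate s :=
      (Real.HolderConjugate.conjExponent hs).symm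
    set p := Real.conjExponent s with hp
    have hηp : η ^ p = κ ^ s := by
      rw [hη, ← Real.rpow_mul hκ.le, hps.symm.sub_one_mul_conj]
    have hηκ : κ ^ s = η * κ := by
      rw [hη, Real.rpow_sub_one hκ.ne', div_mul_cancel₀ _ hκ.ne']
    set D : ℕ → ℝ := fun t =>
      bregman Ψ (state ((List.ofFn f).take t)).2 w (state ((List.ofFn f).take t)).1 with hD
    have hstep : ∀ t : Fin n,
        f t (state ((List.ofFn f).take t)).1 - f t w ≤ (D t - D (t + 1)) / η + κ := by
      intro t
      have htake : (List.ofFn f).take (t + 1) = (List.ofFn f).take t ++ [f t] := by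
        rw [List.take_add_one, List.getElem?_eq_getElem (by simp)]
        simp
      set S := state ((List.ofFn f).take t) with hS
      obtain ⟨hgX, hgsub⟩ := hgrad (f t) (hf t) S.1 S.1.2
      have h1 := mirrorDescent_step_le hps hηpos.le huc (w := w) S.1.2
        (next S (f t)).1.2 (hsub _) (le_trans (by positivity) (hN _))
        (hXN _ (hX _ hgX) _) (hnext3 S (f t) w hw)
      have h2 := hgsub w hw
      have h3 : η ^ p / p ≤ η * κ := by
        rw [hηp, ← hηκ]
        exact div_le_self (by positivity) hps.lt.le
      have h4 : D (t + 1) = bregman Ψ (next S (f t)).2 w (next S (f t)).1 := by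
        simp only [hD, htake, hsucc, hS]
      have h5 : D t = bregman Ψ S.2 w S.1 := rfl
      rw [← sub_le_iff_le_add, le_div_iff₀ hηpos, h4, h5]
      simp only [map_sub] at h1 h2
      nlinarith
    calc ∑ t : Fin n, (f t (state ((List.ofFn f).take t)).1 - f t w)
        ≤ ∑ t : Fin n, ((D t - D (t + 1)) / η + κ) := Finset.sum_le_sum fun t _ => hstep t
      _ = (D 0 - D n) / η + n * κ := by
          rw [Fin.sum_univ_eq_sum_range (fun t => (D t - D (t + 1)) / η + κ),
            Finset.sum_add_distrib, ← Finset.sum_div, Finset.sum_range_sub']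
          simp
      _ ≤ n * κ ^ s / η + n * κ := by
          have h1 : D 0 = Ψ w := by simp [hD, hstate, bregman, hΨ0]
          have h2 : 0 ≤ D n := by
            have := hsub ((List.ofFn f).take n) w (Set.mem_univ w)
            simp only [hD, bregman]
            linarith
          have h3 := hle w hw
          gcongr
          linarith
      _ = n * (2 * κ) := by
          rw [hηκ]
          field_simp
          ring

end MirrorDescent

/-! ### The choice of the exponent -/

/-- The regularizer with exponent `q + 1 / L`, where `L = log n`, is small enough for the regret
bound. -/
theorem regularizer_bound_le {V q : ℝ} (hV : 0 < V) (hq : 2 ≤ q) {n : ℕ}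
    (hL : 1 ≤ Real.log n) :
    (16 * V) ^ (q + 1 / Real.log n) / ((q + 1 / Real.log n) * (q + 1 / Real.log n - q)) ≤
      n * (3001 * V * Real.log n ^ 2 * (n : ℝ) ^ (-(1 / q))) ^ (q + 1 / Real.log n) := by
  have hn : (0 : ℝ) < n := by
    rcases Nat.eq_zero_or_pos n with rfl | h
    · norm_num at hL
    · exact_mod_cast h
  set L := Real.log n with hLdef
  set s := q + 1 / L with hs
  have hL0 : 0 < L := by linarith
  have hqs : q ≤ s := by rw [hs]; simp [hL0.le]
  have hs1 : 1 ≤ s := by linarith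
  have hexp : 1 / 3 ≤ (n : ℝ) * ((n : ℝ) ^ (-(1 / q))) ^ s := by
    rw [← Real.rpow_mul hn.le, ← Real.rpow_one_add' hn.le, Real.rpow_def_of_pos hn, ← hLdef]
    · have h1 : L * (1 + -(1 / q) * s) = -(1 / q) := by
        rw [hs]; field_simp; ring
      have h2 : 1 / q ≤ 1 / 2 := by gcongr
      have h3 := Real.add_one_le_exp (-(1 / q))
      rw [h1]
      linarith
    · intro h0
      have h1 : L * (1 + -(1 / q) * s) = -(1 / q) := by
        rw [hs]; field_simp; ring
      rw [h0, mul_zero] at h1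
      have : 0 < 1 / q := by positivity
      linarith
  have hpow : L ≤ (L ^ 2) ^ s := by
    calc L ≤ L ^ 2 := by nlinarith
      _ ≤ (L ^ 2) ^ s := by
        have := Real.rpow_le_rpow_of_exponent_le (one_le_pow₀ hL (n := 2)) hs1
        rwa [Real.rpow_one] at this
  have hconst : 3 * (16 * V) ^ s ≤ (3001 * V) ^ s := by
    have h1 : (3 : ℝ) ≤ 3 ^ s := by
      have := Real.rpow_le_rpow_of_exponent_le (by norm_num : (1 : ℝ) ≤ 3) hs1
      rwa [Real.rpow_one] at this
    calc 3 * (16 * V) ^ s ≤ 3 ^ s * (16 * V) ^ s := by gcongr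
      _ = (3 * (16 * V)) ^ s := (Real.mul_rpow (by norm_num) (by positivity)).symm
      _ ≤ (3001 * V) ^ s := by
        refine Real.rpow_le_rpow (by positivity) (by linarith) (by linarith)
  have h16 : 0 ≤ (16 * V) ^ s := by positivity
  calc (16 * V) ^ s / (s * (s - q)) = (16 * V) ^ s * L / s := by
        rw [show s - q = 1 / L by rw [hs]; ring]
        field_simp
    _ ≤ (16 * V) ^ s * L := div_le_self (by positivity) hs1
    _ = 3 * (16 * V) ^ s * L * (1 / 3) := by ring
    _ ≤ (3001 * V) ^ s * (L ^ 2) ^ s * ((n : ℝ) * ((n : ℝ) ^ (-(1 / q))) ^ s) := by gcongr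
    _ = n * (3001 * V * L ^ 2 * (n : ℝ) ^ (-(1 / q))) ^ s := by
        rw [Real.mul_rpow (x := 3001 * V * L ^ 2) (by positivity) (by positivity),
          Real.mul_rpow (x := 3001 * V) (by positivity) (by positivity)]
        ring

theorem mainTheorem1 {B : Type*} [NormedAddCommGroup B] [NormedSpace ℝ B] [CompleteSpace B]
    (W : Set B) (hWclosed : IsClosed W) (hWconvex : Convex ℝ W)
    (hWsymm : ∀ w ∈ W, -w ∈ W) (hWabs : Absorbent ℝ W)
    (X : Set (StrongDual ℝ B)) (hXconvex : Convex ℝ X)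
    (hXsymm : ∀ x ∈ X, -x ∈ X) (hXabs : Absorbent ℝ X)
    (V : ℝ) (hV : 0 < V) (q : ℝ) (hq : 2 ≤ q)
    (hvalue : ∀ m : ℕ, 1 ≤ m →
      gameValue W (linearCosts X) m ≤ ((V * (m : ℝ) ^ (-(1 / q)) : ℝ) : EReal))
    (n : ℕ) (hn : Real.exp (q - 1) < (n : ℝ)) :
    ∃ (Ψ : B → ℝ) (η : ℝ), IsRegularizer W X Ψ ∧ 0 < η ∧
      ∀ grad : (B → ℝ) → B → StrongDual ℝ B, IsSubgradientOracle W X grad →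
        ∃ (A : OnlineAlgorithm W) (gradΨ : List (B → ℝ) → StrongDual ℝ B),
          IsMirrorDescent X Ψ η grad gradΨ A ∧
          ∀ f : Fin n → B → ℝ, (∀ t, f t ∈ convexCosts W X) →
            regret A f ≤
              ((6002 * V * Real.log (n : ℝ) ^ 2 * (n : ℝ) ^ (-(1 / q)) : ℝ) : EReal) := by
  have hn0 : (0 : ℝ) < n := (Real.exp_pos _).trans hn
  have hL : 1 ≤ Real.log n := by
    have := (Real.lt_log_iff_exp_lt hn0).2 hn
    linarith
  obtain ⟨r, hr, hball⟩ := exists_closedBall_subset_of_absorbent hWclosed hWconvex hWsymm hWabs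
  obtain ⟨ρ, hρ, hXball⟩ := exists_mul_norm_le_of_absorbent hXconvex hXsymm hXabs
  have hXW : ∀ x ∈ X, ∀ w ∈ W, x w ≤ V :=
    apply_le_of_gameValue_one_le hWsymm hXsymm (by simpa using hvalue 1 le_rfl)
  have hpair : IsBoundedPair W X V :=
    { convex := hWconvex
      neg_mem_left := hWsymm
      zero_mem_left := hWabs.zero_mem
      neg_mem_right := hXsymm
      zero_mem_right := hXabs.zero_mem
      apply_le := hXW
      bddAbove := fun x => ⟨‖x‖ * (V / ρ), by
        rintro _ ⟨w, rfl⟩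
        refine (le_abs_self _).trans ((x.le_opNorm _).trans ?_)
        gcongr
        rw [le_div_iff₀ hρ, mul_comm]
        exact hXball w V fun y hy => hXW y hy w w.2⟩ }
  have hXdual : ∀ (δ : B), ∀ x ∈ X, x δ ≤ V / r * ‖δ‖ := fun δ x hx =>
    (le_abs_self _).trans ((x.le_opNorm δ).trans (mul_le_mul_of_nonneg_right
      (IsBoundedPair.norm_le_of_closedBall_subset hr hball hV.le (hXW x hx)) (norm_nonneg δ)))
  set s := q + 1 / Real.log n with hs
  have hL1 : 1 / Real.log n ≤ 1 := (div_le_one (by linarith)).2 hL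
  have hL2 : 0 < 1 / Real.log n := by positivity
  obtain ⟨Ψ, hconv, hcont, hnonneg, hzero, huc, hΨle⟩ := hpair.exists_regularizer hV hXconvex
    hXabs hr hball hq (s := s) (by linarith) (by linarith) fun m hm =>
      hpair.walkValue_zero_le_of_gameValue_le hm (hvalue m hm)
  set κ := 3001 * V * Real.log n ^ 2 * (n : ℝ) ^ (-(1 / q)) with hκdef
  have hκ : 0 < κ := by
    have h1 : 0 < Real.log n := by linarith
    have h2 : 0 < (n : ℝ) ^ (-(1 / q)) := Real.rpow_pos_of_pos hn0 _
    positivity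
  refine ⟨Ψ, κ ^ (s - 1), ⟨hconv, hnonneg, hzero, s, by linarith, huc⟩,
    Real.rpow_pos_of_pos hκ _, fun grad hgrad => ?_⟩
  have h2κ : 6002 * V * Real.log (n : ℝ) ^ 2 * (n : ℝ) ^ (-(1 / q)) = 2 * κ := by
    rw [hκdef]; ring
  rw [h2κ]
  exact exists_mirrorDescent_regret_le hWclosed hWconvex hpair.zero_mem_left hXsymm hconv hcont
    hnonneg hzero (by linarith) hρ
    (fun w => hXball w _ fun x hx => le_dualGauge hXconvex hXabs (hXdual w) hx)
    (fun x hx w => le_dualGauge hXconvex hXabs (hXdual w) hx) huc hpair.bddAbove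
    (by exact_mod_cast hn0) hκ
    (fun w hw => (hΨle w hw).trans (regularizer_bound_le hV hq hL)) grad hgrad
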